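/- Let $\mathbb{H}$ be the real quaternions and let $c=(c_n)_{n\in\mathbb{Z}}\subseteq\mathbb{H}$ be a non-trivial positive definite sequence: for every $n\ge 0$ the Toeplitz matrix $T_n(c)$ with entry $c_{j-k}$ in row $k$ and column $j$ ($0\le j,k\le n$) satisfies $\xi^*T_n(c)\xi>0$ (real and positive) for all nonzero $\xi\in\mathbb{H}^{n+1}$. For polynomials $\varphi(p)=\sum_k p^k\varphi_k$, $\psi(p)=\sum_k p^k\psi_k$ with coefficients on the right put $\langle\varphi,\psi\rangle_R=\sum_{k,\ell}\overline{\psi_\ell}\,c_{k-\ell}\,\varphi_k$, and for polynomials $\varphi(p)=\sum_k\varphi_kp^k$, $\psi(p)=\sum_k\psi_kp^k$ with coefficients on the left put $\langle\varphi,\psi\rangle_L=\sum_{k,\ell}\varphi_k\,c_{k-\ell}\,\overline{\psi_\ell}$. Let the right-orthonormal polynomials $(\psi_n^R)_{n\ge0}$ (coefficients on the right) and the left-orthonormal polynomials $(\psi_n^L)_{n\ge0}$ (coefficients on the left) be obtained from $1,p,p^2,\dots$ by the Gram--Schmidt process with respect to $\langle\cdot,\cdot\rangle_R$ and $\langle\cdot,\cdot\rangle_L$,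 respectively. For $\psi_n^R(p)=\sum_{k=0}^n p^k a_k$ and $\psi_n^L(p)=\sum_{k=0}^n b_k p^k$ the reverse polynomials are $\psi_n^{R,\#}(p)=\sum_{k=0}^n\overline{a_k}\,p^{n-k}$ and $\psi_n^{L,\#}(p)=\sum_{k=0}^n p^{n-k}\,\overline{b_k}$; for $p\neq0$ these equal $\overline{\psi_n^R(1/\overline p)}\,p^n$ and $p^n\,\overline{\psi_n^L(1/\overline p)}$. Write $\mathcal{Z}(\varphi)=\{q\in\mathbb{H}:\varphi(q)=0\}$. Then for every $n\ge0$: 1. $\mathcal{Z}(\psi_n^L)$ and $\mathcal{Z}(\psi_n^R)$ are contained in the open unit ball $\{q\in\mathbb{H}:|q|<1\}$; 2. $\mathcal{Z}(\psi_n^{L,\#})$ and $\mathcal{Z}(\psi_n^{R,\#})$ are contained in $\{q\in\mathbb{H}:|q|>1\}$, the complement of the closed unit ball; 3. $\mathcal{Z}(\psi_n^L)$ and $\mathcal{Z}(\psi_n^R)$ meet the same similarity classes, that is, $$\{uzu^{-1}: z\in\mathcal{Z}(\psi_n^L),\ u\in\mathbb{H}\setminus\{0\}\}=\{uzu^{-1}: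 z\in\mathcal{Z}(\psi_n^R),\ u\in\mathbb{H}\setminus\{0\}\}.$$ -/

import Mathlib

open Polynomial
open scoped Quaternion

namespace QuatOPUC

/-- A quaternion that is real and strictly positive. -/
def IsPosReal (q : ℍ[ℝ]) : Prop := q.im = 0 ∧ 0 < q.re

/-- A quaternionic matrix `A` is positive definite if `ξ^* A ξ > 0` for all nonzero columns `ξ`. -/
def IsPosDefMatrix {m : ℕ} (A : Matrix (Fin m) (Fin m) ℍ[ℝ]) : Prop :=
  ∀ ξ : Fin m → ℍ[ℝ], ξ ≠ 0 → IsPosReal (star ξ ⬝ᵥ Matrix.mulVec A ξ)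

/-- The `(n+1) × (n+1)` Toeplitz matrix `T_n(c)`, with entry `c (j - k)` in row `k`, column `j`. -/
def toeplitz (c : ℤ → ℍ[ℝ]) (n : ℕ) : Matrix (Fin (n + 1)) (Fin (n + 1)) ℍ[ℝ] :=
  Matrix.of fun k j => c (((j : ℕ) : ℤ) - ((k : ℕ) : ℤ))

/-- Non-trivial positive definite sequences: every `T_n(c)` is positive definite. -/
def IsNontrivialPosDef (c : ℤ → ℍ[ℝ]) : Prop :=
  ∀ n : ℕ, IsPosDefMatrix (toeplitz c n)

/-!
A polynomial of either kind is stored through its coefficients, as an element of `ℍ[ℝ][X]`.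
The same coefficients `a_k` give the polynomial `∑ p^k a_k` (coefficients on the right, left-slice
hyperholomorphic) and the polynomial `∑ a_k p^k` (coefficients on the left, right-slice
hyperholomorphic). The two are told apart by the evaluation that is used.
-/

/-- The value at `q` of the left-slice hyperholomorphic polynomial `∑ p^k a_k`. -/
noncomputable def evalLS (q : ℍ[ℝ]) (φ : ℍ[ℝ][X]) : ℍ[ℝ] := φ.sum fun k a => q ^ k * a

/-- The value at `q` of the right-slice hyperholomorphic polynomial `∑ a_k p^k`. -/
noncomputable def evalRS (q : ℍ[ℝ]) (φ : ℍ[ℝ][X]) : ℍ[ℝ] := φ.sum fun k a => a * q ^ k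

/-- Zero set of the left-slice hyperholomorphic polynomial with coefficients `φ`. -/
def zerosLS (φ : ℍ[ℝ][X]) : Set ℍ[ℝ] := {q | evalLS q φ = 0}

/-- Zero set of the right-slice hyperholomorphic polynomial with coefficients `φ`. -/
def zerosRS (φ : ℍ[ℝ][X]) : Set ℍ[ℝ] := {q | evalRS q φ = 0}

/-- The coefficient vector `(φ_0, …, φ_N)`. -/
noncomputable def coeffVec (N : ℕ) (φ : ℍ[ℝ][X]) : Fin (N + 1) → ℍ[ℝ] := fun k => φ.coeff k

/-- `⟨φ, ψ⟩_R = ψ̂^* T_N(c) φ̂ = ∑ conj(ψ_l) c_{k-l} φ_k` for left-slice hyperholomorphic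
polynomials, with `N` the larger degree. -/
noncomputable def formR (c : ℤ → ℍ[ℝ]) (φ ψ : ℍ[ℝ][X]) : ℍ[ℝ] :=
  star (coeffVec (max φ.natDegree ψ.natDegree) ψ) ⬝ᵥ
    Matrix.mulVec (toeplitz c (max φ.natDegree ψ.natDegree))
      (coeffVec (max φ.natDegree ψ.natDegree) φ)

/-- `⟨φ, ψ⟩_L = ∑ φ_k c_{k-l} conj(ψ_l)` for right-slice hyperholomorphic polynomials. The matrix
with entry `c_{k-l}` in row `k`, column `l` is the transpose of `T_N(c)`. -/
noncomputable def formL (c : ℤ → ℍ[ℝ]) (φ ψ : ℍ[ℝ][X]) : ℍ[ℝ] :=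
  Matrix.vecMul (coeffVec (max φ.natDegree ψ.natDegree) φ)
      (toeplitz c (max φ.natDegree ψ.natDegree)).transpose ⬝ᵥ
    star (coeffVec (max φ.natDegree ψ.natDegree) ψ)

/-- Right-orthonormal polynomials `ψ_n^R` (left-slice hyperholomorphic): Gram–Schmidt applied to
`1, p, p², …` with the form `⟨·,·⟩_R` and coefficients on the right. -/
noncomputable def rightON (c : ℤ → ℍ[ℝ]) (n : ℕ) : ℍ[ℝ][X] :=
  let m : ℍ[ℝ][X] :=
    X ^ n - ∑ k : Fin n, rightON c k.1 * C (formR c (X ^ n) (rightON c k.1))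
  m * C (((Real.sqrt (formR c m m).re)⁻¹ : ℝ) : ℍ[ℝ])
termination_by n
decreasing_by all_goals exact k.2

/-- Left-orthonormal polynomials `ψ_n^L` (right-slice hyperholomorphic): Gram–Schmidt applied to
`1, p, p², …` with the form `⟨·,·⟩_L` and coefficients on the left. -/
noncomputable def leftON (c : ℤ → ℍ[ℝ]) (n : ℕ) : ℍ[ℝ][X] :=
  let m : ℍ[ℝ][X] :=
    X ^ n - ∑ k : Fin n, C (formL c (X ^ n) (leftON c k.1)) * leftON c k.1
  C (((Real.sqrt (formL c m m).re)⁻¹ : ℝ) : ℍ[ℝ]) * m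
termination_by n
decreasing_by all_goals exact k.2

/-- Coefficients of the reverse polynomial: for `φ` of degree `n`, the coefficient of `p^(n-k)` is
the conjugate of the coefficient of `p^k` in `φ`. Reversal exchanges the two kinds of polynomials;
see `evalRS_reversePoly` and `evalLS_reversePoly`. -/
noncomputable def reversePoly (φ : ℍ[ℝ][X]) : ℍ[ℝ][X] :=
  ∑ k ∈ Finset.range (φ.natDegree + 1), monomial (φ.natDegree - k) (star (φ.coeff k))

theorem evalRS_reversePoly (φ : ℍ[ℝ][X]) (p : ℍ[ℝ]) (hp : p ≠ 0) :
    evalRS p (reversePoly φ) = star (evalLS (star p)⁻¹ φ) * p ^ φ.natDegree := by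
  have h : evalRS p (reversePoly φ) = (reversePoly φ).eval p := by
    rw [evalRS, eval_eq_sum]
  rw [h, reversePoly, eval_finsetSum, evalLS,
    sum_over_range φ (by intro n; simp), star_sum, Finset.sum_mul]
  refine Finset.sum_congr rfl fun k hk => ?_
  have hk' : k ≤ φ.natDegree := by have := Finset.mem_range.1 hk; omega
  rw [eval_monomial, star_mul, star_pow, star_inv₀, star_star, mul_assoc, inv_pow]
  rw [show p ^ φ.natDegree = p ^ k * p ^ (φ.natDegree - k) by rw [← pow_add]; congr 1; omega]
  rw [inv_mul_cancel_left₀ (pow_ne_zero k hp)]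

theorem evalLS_reversePoly (ψ : ℍ[ℝ][X]) (p : ℍ[ℝ]) (hp : p ≠ 0) :
    evalLS p (reversePoly ψ) = p ^ ψ.natDegree * star (evalRS (star p)⁻¹ ψ) := by
  have hadd : ∀ f g : ℍ[ℝ][X], evalLS p (f + g) = evalLS p f + evalLS p g := fun f g =>
    sum_add_index f g _ (by simp) (by intros; rw [mul_add])
  let L : ℍ[ℝ][X] →+ ℍ[ℝ] :=
    { toFun := evalLS p, map_zero' := by simp [evalLS], map_add' := hadd }
  have hL : ∀ f, L f = evalLS p f := fun _ => rfl
  rw [← hL, reversePoly, map_sum, evalRS,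
    sum_over_range ψ (by intro n; simp), star_sum, Finset.mul_sum]
  refine Finset.sum_congr rfl fun k hk => ?_
  have hk' : k ≤ ψ.natDegree := by have := Finset.mem_range.1 hk; omega
  rw [hL, evalLS, sum_monomial_index _ _ (by simp), star_mul, star_pow, star_inv₀, star_star,
    ← mul_assoc, inv_pow]
  rw [show p ^ ψ.natDegree = p ^ (ψ.natDegree - k) * p ^ k by rw [← pow_add]; congr 1; omega]
  rw [mul_inv_cancel_right₀ (pow_ne_zero k hp)]

/-- The union of the similarity classes `{u z u⁻¹ : u ≠ 0}` of the elements `z` of `Z`. -/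
def simClosure (Z : Set ℍ[ℝ]) : Set ℍ[ℝ] := {q | ∃ z ∈ Z, ∃ u : ℍ[ℝ], u ≠ 0 ∧ q = u * z * u⁻¹}

end QuatOPUC

/-! Two reductions leave one family of polynomials and one evaluation. On a similarity class each
power is affine, `q ^ k = a + b * q` with real `a`, `b`, so the two evaluations of the same
coefficients are `A + q * B` and `A + B * q`, and conjugating by `B` carries zeros of one to zeros
of the other (`simClosure_zerosLS`). Coefficientwise conjugation reverses products and turns the
left polynomials of `c` into the right polynomials of `star ∘ c` (`leftON_eq`).

Location: a zero `q` of ψ = `rightON c n` under `evalRS` splits off a right factor, so `X * g = ψ +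
g * C q` with g of degree below n, hence orthogonal to ψ. Shift invariance of the Toeplitz form
gives ⟨g,g⟩ = ⟨Xg,Xg⟩ = 1 + |q|²⟨g,g⟩, which forces |q| < 1. Reversal sends a nonzero zero p to
1/conj(p), and its value at 0 is the conjugate of the nonzero leading coefficient.

Equal classes: the polynomials of `c` and `star ∘ c` must be compared. Orthogonality of `X * g - g *
C q` to lower powers makes q a right eigenvalue of (Toeplitz inverse) · (shifted Toeplitz). By
`exists_vecMul_eq_smul` a similar r is a left eigenvalue on row vectors. Reversing and conjugating
the resulting row gives f with `f * (X - C (star r))` orthogonal to lower powers for `star ∘ c`,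
hence a multiple of the orthonormal polynomial (`eq_rightON_mul_C`). -/

namespace QuatOPUC

/-! ### Similarity classes and the two evaluations -/

/-- Two quaternions with the same real part and the same norm, i.e. similar quaternions. -/
def SameClass (p q : ℍ[ℝ]) : Prop := p.re = q.re ∧ Quaternion.normSq p = Quaternion.normSq q

theorem SameClass.refl (q : ℍ[ℝ]) : SameClass q q := ⟨rfl, rfl⟩

theorem SameClass.symm {p q : ℍ[ℝ]} (h : SameClass p q) : SameClass q p := ⟨h.1.symm, h.2.symm⟩

theorem SameClass.trans {p q r : ℍ[ℝ]} (h : SameClass p q) (h' : SameClass q r) :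
    SameClass p r := ⟨h.1.trans h'.1, h.2.trans h'.2⟩

theorem sameClass_star (q : ℍ[ℝ]) : SameClass (star q) q := by
  simp [SameClass]

theorem sameClass_conj (q : ℍ[ℝ]) {u : ℍ[ℝ]} (hu : u ≠ 0) : SameClass (u * q * u⁻¹) q := by
  have hn : Quaternion.normSq u ≠ 0 := by simpa using hu
  refine ⟨?_, ?_⟩
  · have h : (u * q * u⁻¹).re = (u⁻¹ * (u * q)).re := by
      simp only [Quaternion.re_mul]; ring
    rw [h, inv_mul_cancel_left₀ hu]
  · simp only [map_mul, map_inv₀]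
    field_simp

theorem SameClass.norm_eq {p q : ℍ[ℝ]} (h : SameClass p q) : ‖p‖ = ‖q‖ := by
  have h2 := h.2
  rw [Quaternion.normSq_eq_norm_mul_self, Quaternion.normSq_eq_norm_mul_self] at h2
  exact (mul_self_inj (norm_nonneg _) (norm_nonneg _)).1 h2

theorem mul_self_eq (q : ℍ[ℝ]) :
    q * q = ((2 * q.re : ℝ) : ℍ[ℝ]) * q - ((Quaternion.normSq q : ℝ) : ℍ[ℝ]) := by
  rw [Quaternion.normSq_def']
  apply Quaternion.ext <;>
    simp only [Quaternion.re_mul, Quaternion.imI_mul, Quaternion.imJ_mul, Quaternion.imK_mul,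
      Quaternion.re_sub, Quaternion.imI_sub, Quaternion.imJ_sub, Quaternion.imK_sub,
      Quaternion.re_coe, Quaternion.imI_coe, Quaternion.imJ_coe, Quaternion.imK_coe] <;> ring

/-- Both elements satisfy the same real quadratic equation, so `u = q - star p` intertwines them. If
`q = star p` this vanishes, and a nonzero purely imaginary `u` orthogonal to the imaginary part of
`p` is used instead. -/
theorem SameClass.exists_conj {p q : ℍ[ℝ]} (h : SameClass p q) :
    ∃ u : ℍ[ℝ], u ≠ 0 ∧ q = u * p * u⁻¹ := by
  suffices H : ∃ u : ℍ[ℝ], u ≠ 0 ∧ q * u = u * p by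
    obtain ⟨u, hu, h⟩ := H
    exact ⟨u, hu, by rw [← h, mul_inv_cancel_right₀ hu]⟩
  by_cases h0 : q = star p
  · subst h0
    obtain ⟨u, hu, hre, hK, h1⟩ : ∃ u : ℍ[ℝ], u ≠ 0 ∧ u.re = 0 ∧ u.imK = 0 ∧
        p.imI * u.imI + p.imJ * u.imJ = 0 := by
      by_cases h1 : p.imI = 0 ∧ p.imJ = 0
      · exact ⟨⟨0, 1, 0, 0⟩, fun h => by simpa using congrArg QuaternionAlgebra.imI h, rfl, rfl,
          by simp [h1.1, h1.2]⟩
      · exact ⟨⟨0, p.imJ, -p.imI, 0⟩, fun h => h1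
          ⟨by simpa using congrArg QuaternionAlgebra.imJ h,
            by simpa using congrArg QuaternionAlgebra.imI h⟩, rfl, rfl, by ring⟩
    refine ⟨u, hu, ?_⟩
    apply Quaternion.ext <;>
      simp only [Quaternion.re_mul, Quaternion.imI_mul, Quaternion.imJ_mul, Quaternion.imK_mul,
        Quaternion.re_star, Quaternion.imI_star, Quaternion.imJ_star, Quaternion.imK_star,
        hre, hK] <;> first | ring1 | linear_combination 2 * h1
  · refine ⟨q - star p, sub_ne_zero.2 h0, ?_⟩
    have e : star p = ((2 * p.re : ℝ) : ℍ[ℝ]) - p := by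
      apply Quaternion.ext <;>
        simp only [Quaternion.re_star, Quaternion.imI_star, Quaternion.imJ_star,
          Quaternion.imK_star, Quaternion.re_sub, Quaternion.imI_sub, Quaternion.imJ_sub,
          Quaternion.imK_sub, Quaternion.re_coe, Quaternion.imI_coe, Quaternion.imJ_coe,
          Quaternion.imK_coe] <;> ring
    have e' : ((Quaternion.normSq p : ℝ) : ℍ[ℝ]) = star p * p := by
      rw [Quaternion.star_mul_self]
    rw [mul_sub, sub_mul, mul_self_eq q, ← h.1, ← h.2, e', e,
      mul_sub q, Quaternion.coe_commutes _ q]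
    abel

theorem mem_simClosure {Z : Set ℍ[ℝ]} {q : ℍ[ℝ]} :
    q ∈ simClosure Z ↔ ∃ z ∈ Z, SameClass z q := by
  constructor
  · rintro ⟨z, hz, u, hu, rfl⟩
    exact ⟨z, hz, (sameClass_conj z hu).symm⟩
  · rintro ⟨z, hz, h⟩
    obtain ⟨u, hu, h⟩ := h.exists_conj
    exact ⟨z, hz, u, hu, h⟩

/-- The quadratic equation `mul_self_eq` has real coefficients depending only on the class, so
powers reduce uniformly modulo it. -/
theorem exists_pow_eq (p : ℍ[ℝ]) (k : ℕ) :
    ∃ a b : ℝ, ∀ q, SameClass q p → q ^ k = (a : ℍ[ℝ]) + (b : ℍ[ℝ]) * q := by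
  induction k with
  | zero => exact ⟨1, 0, fun q _ => by simp⟩
  | succ k ih =>
    obtain ⟨a, b, h⟩ := ih
    refine ⟨-(b * Quaternion.normSq p), a + b * (2 * p.re), fun q hq => ?_⟩
    rw [pow_succ, h q hq, add_mul, mul_assoc, mul_self_eq, hq.1, hq.2]
    push_cast
    noncomm_ring

/-- On a similarity class both evaluations are affine, with the same coefficients. -/
theorem exists_eval_eq (p : ℍ[ℝ]) (φ : ℍ[ℝ][X]) :
    ∃ A B : ℍ[ℝ], ∀ q, SameClass q p → evalLS q φ = A + q * B ∧ evalRS q φ = A + B * q := by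
  choose a b h using exists_pow_eq p
  refine ⟨φ.sum fun k x => (a k : ℍ[ℝ]) * x, φ.sum fun k x => (b k : ℍ[ℝ]) * x, fun q hq => ?_⟩
  simp only [evalLS, evalRS, Polynomial.sum, Finset.mul_sum, Finset.sum_mul,
    ← Finset.sum_add_distrib]
  refine ⟨Finset.sum_congr rfl fun k _ => ?_, Finset.sum_congr rfl fun k _ => ?_⟩
  · rw [h k q hq, add_mul, ← mul_assoc, Quaternion.coe_commutes (b k) q]
  · rw [h k q hq, mul_add, mul_assoc (b k : ℍ[ℝ]), Quaternion.coe_commutes (a k),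
      ← mul_assoc _ (b k : ℍ[ℝ]), ← Quaternion.coe_commutes (b k), mul_assoc]

theorem exists_evalRS_eq_zero {q : ℍ[ℝ]} {φ : ℍ[ℝ][X]} (h : evalLS q φ = 0) :
    ∃ q', SameClass q' q ∧ evalRS q' φ = 0 := by
  obtain ⟨A, B, H⟩ := exists_eval_eq q φ
  rw [(H q (.refl q)).1] at h
  by_cases hB : B = 0
  · exact ⟨q, .refl q, by rw [(H q (.refl q)).2]; simpa [hB] using h⟩
  · have hs : SameClass (B⁻¹ * q * B) q := by
      simpa using sameClass_conj q (inv_ne_zero hB)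
    exact ⟨_, hs, by rw [(H _ hs).2, mul_assoc, mul_inv_cancel_left₀ hB, h]⟩

theorem exists_evalLS_eq_zero {q : ℍ[ℝ]} {φ : ℍ[ℝ][X]} (h : evalRS q φ = 0) :
    ∃ q', SameClass q' q ∧ evalLS q' φ = 0 := by
  obtain ⟨A, B, H⟩ := exists_eval_eq q φ
  rw [(H q (.refl q)).2] at h
  by_cases hB : B = 0
  · exact ⟨q, .refl q, by rw [(H q (.refl q)).1]; simpa [hB] using h⟩
  · have hs : SameClass (B * q * B⁻¹) q := sameClass_conj q hB
    exact ⟨_, hs, by rw [(H _ hs).1, inv_mul_cancel_right₀ hB, h]⟩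

theorem simClosure_zerosLS (φ : ℍ[ℝ][X]) : simClosure (zerosLS φ) = simClosure (zerosRS φ) := by
  ext q
  simp only [mem_simClosure]
  constructor
  · rintro ⟨z, hz, h⟩
    obtain ⟨z', h', hz'⟩ := exists_evalRS_eq_zero hz
    exact ⟨z', hz', h'.trans h⟩
  · rintro ⟨z, hz, h⟩
    obtain ⟨z', h', hz'⟩ := exists_evalLS_eq_zero hz
    exact ⟨z', hz', h'.trans h⟩

theorem evalRS_eq_eval (q : ℍ[ℝ]) (φ : ℍ[ℝ][X]) : evalRS q φ = φ.eval q := by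
  rw [evalRS, eval_eq_sum]

/-- Subtract the vanishing constant ∑ a_k q^k from φ; each X^k - q^k is a geometric sum times X - q
because `X` commutes with `C q`. -/
theorem exists_eq_mul_X_sub_C {q : ℍ[ℝ]} {φ : ℍ[ℝ][X]} (h : evalRS q φ = 0) :
    ∃ g : ℍ[ℝ][X], φ = g * (X - C q) := by
  refine ⟨φ.sum fun k a => C a * ∑ i ∈ Finset.range k, X ^ i * C q ^ (k - 1 - i), ?_⟩
  have hq : (φ.sum fun k a => C a * C q ^ k) = 0 := by
    rw [← C_0, ← h, evalRS]
    simp [Polynomial.sum]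
  have e : ∀ k : ℕ, (∑ i ∈ Finset.range k, X ^ i * C q ^ (k - 1 - i)) * (X - C q)
      = X ^ k - C q ^ k := fun k => (commute_X (C q)).geom_sum₂_mul k
  conv_lhs => rw [← sub_zero φ, ← hq]; enter [1]; rw [← sum_C_mul_X_pow_eq φ]
  simp only [Polynomial.sum, Finset.sum_mul, mul_assoc, e]
  simp only [mul_sub, Finset.sum_sub_distrib]

/-! ### Coefficientwise conjugation -/

/-- Coefficientwise conjugation, as an anti-automorphism of `ℍ[ℝ][X]`. -/
noncomputable def conjEquiv : ℍ[ℝ][X] ≃+* ℍ[ℝ][X]ᵐᵒᵖ :=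
  (mapEquiv starRingEquiv).trans (opRingEquiv ℍ[ℝ]).symm

/-- The polynomial with conjugate coefficients. -/
noncomputable def conjPoly (φ : ℍ[ℝ][X]) : ℍ[ℝ][X] := (conjEquiv φ).unop

@[simp]
theorem coeff_conjPoly (φ : ℍ[ℝ][X]) (k : ℕ) : (conjPoly φ).coeff k = star (φ.coeff k) := by
  have h := coeff_opRingEquiv (conjEquiv φ) k
  rw [conjEquiv, RingEquiv.trans_apply, RingEquiv.apply_symm_apply, mapEquiv_apply, coeff_map] at h
  exact (MulOpposite.op_injective h).symm

theorem conjPoly_mul (φ ψ : ℍ[ℝ][X]) : conjPoly (φ * ψ) = conjPoly ψ * conjPoly φ := by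
  simp [conjPoly]

theorem conjPoly_sub (φ ψ : ℍ[ℝ][X]) : conjPoly (φ - ψ) = conjPoly φ - conjPoly ψ := by
  simp [conjPoly]

theorem conjPoly_sum {ι : Type*} (s : Finset ι) (f : ι → ℍ[ℝ][X]) :
    conjPoly (∑ i ∈ s, f i) = ∑ i ∈ s, conjPoly (f i) := by
  simp [conjPoly]

@[simp]
theorem conjPoly_C (a : ℍ[ℝ]) : conjPoly (C a) = C (star a) := by
  ext1 k
  rw [coeff_conjPoly, coeff_C, coeff_C]
  split_ifs <;> simp

@[simp]
theorem conjPoly_X_pow (n : ℕ) : conjPoly (X ^ n) = X ^ n := by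
  ext1 k
  rw [coeff_conjPoly, coeff_X_pow]
  split_ifs <;> simp

@[simp]
theorem support_conjPoly (φ : ℍ[ℝ][X]) : (conjPoly φ).support = φ.support := by
  ext k
  simp

@[simp]
theorem natDegree_conjPoly (φ : ℍ[ℝ][X]) : (conjPoly φ).natDegree = φ.natDegree := by
  simp [natDegree, degree]

@[simp]
theorem conjPoly_conjPoly (φ : ℍ[ℝ][X]) : conjPoly (conjPoly φ) = φ := by
  ext1 k
  simp

theorem evalRS_conjPoly (q : ℍ[ℝ]) (φ : ℍ[ℝ][X]) :
    evalRS q (conjPoly φ) = star (evalLS (star q) φ) := by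
  simp [evalRS, evalLS, Polynomial.sum, star_sum]

/-! ### The Toeplitz form -/

/-- The right form restricted to polynomials of degree less than `N`. -/
noncomputable def toeplitzForm (c : ℤ → ℍ[ℝ]) (N : ℕ) (φ ψ : ℍ[ℝ][X]) : ℍ[ℝ] :=
  ∑ l ∈ Finset.range N, ∑ k ∈ Finset.range N, star (ψ.coeff l) * c ((k : ℤ) - l) * φ.coeff k

theorem toeplitzForm_eq_of_le (c : ℤ → ℍ[ℝ]) {N M : ℕ} (hNM : N ≤ M) {φ ψ : ℍ[ℝ][X]}
    (hφ : φ.natDegree < N) (hψ : ψ.natDegree < N) :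
    toeplitzForm c M φ ψ = toeplitzForm c N φ ψ := by
  have hs : Finset.range N ⊆ Finset.range M := Finset.range_subset_range.2 hNM
  unfold toeplitzForm
  rw [← Finset.sum_subset hs]
  · refine Finset.sum_congr rfl fun l _ => (Finset.sum_subset hs fun k _ hk => ?_).symm
    rw [coeff_eq_zero_of_natDegree_lt (p := φ) (by simp at hk; omega), mul_zero]
  · intro l _ hl
    rw [coeff_eq_zero_of_natDegree_lt (p := ψ) (by simp at hl; omega)]
    simp

theorem dotProduct_toeplitz_mulVec (c : ℤ → ℍ[ℝ]) (n : ℕ) (φ ψ : ℍ[ℝ][X]) :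
    star (coeffVec n ψ) ⬝ᵥ Matrix.mulVec (toeplitz c n) (coeffVec n φ) =
      toeplitzForm c (n + 1) φ ψ := by
  simp only [dotProduct, Matrix.mulVec, toeplitzForm, Finset.sum_range, coeffVec, toeplitz,
    Finset.mul_sum, Pi.star_apply, Matrix.of_apply, mul_assoc]

theorem formR_eq (c : ℤ → ℍ[ℝ]) {N : ℕ} {φ ψ : ℍ[ℝ][X]} (hφ : φ.natDegree < N)
    (hψ : ψ.natDegree < N) : formR c φ ψ = toeplitzForm c N φ ψ := by
  rw [formR, dotProduct_toeplitz_mulVec, ← toeplitzForm_eq_of_le c (M := N)] <;> omega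

theorem formL_eq (c : ℤ → ℍ[ℝ]) (φ ψ : ℍ[ℝ][X]) :
    formL c φ ψ = star (formR (star ∘ c) (conjPoly φ) (conjPoly ψ)) := by
  rw [formR, dotProduct_toeplitz_mulVec, formL, natDegree_conjPoly, natDegree_conjPoly]
  simp only [dotProduct, Matrix.vecMul, toeplitzForm, Finset.sum_range, coeffVec, toeplitz,
    Finset.sum_mul, Pi.star_apply, Matrix.of_apply, Matrix.transpose_apply, star_sum, star_mul,
    coeff_conjPoly, star_star, Function.comp, mul_assoc]

theorem leftON_eq (c : ℤ → ℍ[ℝ]) (n : ℕ) :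
    leftON c n = conjPoly (rightON (star ∘ c) n) := by
  induction n using Nat.strong_induction_on with
  | _ n ih =>
    have hm : X ^ n - ∑ k : Fin n, C (formL c (X ^ n) (leftON c k.1)) * leftON c k.1 =
        conjPoly (X ^ n - ∑ k : Fin n, rightON (star ∘ c) k.1 *
          C (formR (star ∘ c) (X ^ n) (rightON (star ∘ c) k.1))) := by
      rw [conjPoly_sub, conjPoly_X_pow, conjPoly_sum]
      congr 1
      refine Finset.sum_congr rfl fun k _ => ?_
      rw [ih k k.2, conjPoly_mul, conjPoly_C, formL_eq, conjPoly_X_pow, conjPoly_conjPoly]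
    have h : ∀ M : ℍ[ℝ][X],
        C (((Real.sqrt (formL c (conjPoly M) (conjPoly M)).re)⁻¹ : ℝ) : ℍ[ℝ]) * conjPoly M =
          conjPoly (M * C (((Real.sqrt (formR (star ∘ c) M M).re)⁻¹ : ℝ) : ℍ[ℝ])) := by
      intro M
      rw [conjPoly_mul, formL_eq, conjPoly_conjPoly, conjPoly_C, Quaternion.re_star,
        Quaternion.star_coe]
    rw [rightON, leftON, hm]
    exact h _

theorem toeplitzForm_add_left (c : ℤ → ℍ[ℝ]) (N : ℕ) (φ φ' ψ : ℍ[ℝ][X]) :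
    toeplitzForm c N (φ + φ') ψ = toeplitzForm c N φ ψ + toeplitzForm c N φ' ψ := by
  simp [toeplitzForm, mul_add, Finset.sum_add_distrib]

theorem toeplitzForm_sub_left (c : ℤ → ℍ[ℝ]) (N : ℕ) (φ φ' ψ : ℍ[ℝ][X]) :
    toeplitzForm c N (φ - φ') ψ = toeplitzForm c N φ ψ - toeplitzForm c N φ' ψ := by
  simp [toeplitzForm, mul_sub, Finset.sum_sub_distrib]

theorem toeplitzForm_sum_left {ι : Type*} (c : ℤ → ℍ[ℝ]) (N : ℕ) (s : Finset ι)
    (f : ι → ℍ[ℝ][X]) (ψ : ℍ[ℝ][X]) :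
    toeplitzForm c N (∑ i ∈ s, f i) ψ = ∑ i ∈ s, toeplitzForm c N (f i) ψ := by
  classical
  induction s using Finset.induction_on with
  | empty => simp [toeplitzForm]
  | insert a s ha ih => rw [Finset.sum_insert ha, Finset.sum_insert ha, toeplitzForm_add_left, ih]

theorem toeplitzForm_mul_C_left (c : ℤ → ℍ[ℝ]) (N : ℕ) (φ ψ : ℍ[ℝ][X]) (a : ℍ[ℝ]) :
    toeplitzForm c N (φ * C a) ψ = toeplitzForm c N φ ψ * a := by
  simp [toeplitzForm, Finset.sum_mul, mul_assoc]

/-- Multiplication by `X` is an isometry, since the entries depend only on index differences. -/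
theorem toeplitzForm_X_mul (c : ℤ → ℍ[ℝ]) (N : ℕ) (φ ψ : ℍ[ℝ][X]) :
    toeplitzForm c (N + 1) (X * φ) (X * ψ) = toeplitzForm c N φ ψ := by
  simp [toeplitzForm, Finset.sum_range_succ']

theorem toeplitzForm_X_pow_right (c : ℤ → ℍ[ℝ]) {N j : ℕ} (hj : j < N) (φ : ℍ[ℝ][X]) :
    toeplitzForm c N φ (X ^ j) = ∑ k ∈ Finset.range N, c ((k : ℤ) - j) * φ.coeff k := by
  rw [toeplitzForm, Finset.sum_eq_single_of_mem j (Finset.mem_range.2 hj)]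
  · simp
  · intro l _ hl
    simp [coeff_X_pow, hl]

/-! ### Positivity -/

theorem toeplitzForm_pos {c : ℤ → ℍ[ℝ]} (hc : IsNontrivialPosDef c) {N : ℕ} {φ : ℍ[ℝ][X]}
    (hφ : φ.natDegree < N) (h0 : φ ≠ 0) : IsPosReal (toeplitzForm c N φ φ) := by
  obtain ⟨n, rfl⟩ : ∃ n, N = n + 1 := ⟨N - 1, by omega⟩
  rw [← dotProduct_toeplitz_mulVec]
  refine hc n _ fun h => h0 (Polynomial.ext fun k => ?_)
  by_cases hk : k < n + 1
  · exact congrFun h ⟨k, hk⟩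
  · exact coeff_eq_zero_of_natDegree_lt (by omega)

theorem toeplitzForm_X_pow_left (c : ℤ → ℍ[ℝ]) {N j : ℕ} (hj : j < N) (ψ : ℍ[ℝ][X]) :
    toeplitzForm c N (X ^ j) ψ = ∑ l ∈ Finset.range N, star (ψ.coeff l) * c ((j : ℤ) - l) := by
  refine Finset.sum_congr rfl fun l _ => ?_
  rw [Finset.sum_eq_single_of_mem j (Finset.mem_range.2 hj)]
  · simp
  · intro k _ hk
    simp [coeff_X_pow, hk]

theorem im_eq_zero_iff {q : ℍ[ℝ]} : q.im = 0 ↔ q.imI = 0 ∧ q.imJ = 0 ∧ q.imK = 0 := by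
  refine ⟨fun h => ⟨?_, ?_, ?_⟩, fun h => Quaternion.ext _ _ rfl h.1 h.2.1 h.2.2⟩
  · rw [← Quaternion.imI_im, h, Quaternion.imI_zero]
  · rw [← Quaternion.imJ_im, h, Quaternion.imJ_zero]
  · rw [← Quaternion.imK_im, h, Quaternion.imK_zero]

/-- Hermitian symmetry follows from reality of the quadratic form, by polarization on 1 + X^n a: a =
1 makes the imaginary parts of c_n and c_{-n} opposite, and a = i makes their real parts equal. -/
theorem neg_natCast_eq_star {c : ℤ → ℍ[ℝ]} (hc : IsNontrivialPosDef c) (n : ℕ) :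
    c (-(n : ℤ)) = star (c n) := by
  have h0 : (c 0).im = 0 := by
    have h := (toeplitzForm_pos hc (N := 1) (φ := X ^ 0) (by simp) (by simp)).1
    rwa [toeplitzForm_X_pow_left c zero_lt_one, Finset.sum_range_one, coeff_X_pow_self, star_one,
      one_mul, sub_self] at h
  obtain rfl | hn := Nat.eq_zero_or_pos n
  · rw [Nat.cast_zero, neg_zero, eq_comm]
    exact Quaternion.star_eq_self.2 (by simpa [h0] using (Quaternion.re_add_im (c 0)).symm)
  have key : ∀ a : ℍ[ℝ], (c 0 + star a * c (-n) + (c n + star a * c 0) * a).im = 0 := by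
    intro a
    have hd : (X ^ 0 + X ^ n * C a : ℍ[ℝ][X]).natDegree < n + 1 :=
      Nat.lt_succ_of_le (natDegree_add_le_of_degree_le (by simp)
        ((natDegree_mul_C_le _ _).trans (natDegree_X_pow_le n)))
    have hne : (X ^ 0 + X ^ n * C a : ℍ[ℝ][X]) ≠ 0 := fun h => by
      have := congrArg (coeff · 0) h
      simp [coeff_X_pow, hn.ne] at this
    have h := (toeplitzForm_pos hc hd hne).1
    have e : ∀ j : ℕ, ∑ l ∈ Finset.range (n + 1),
        star ((X ^ 0 + X ^ n * C a : ℍ[ℝ][X]).coeff l) * c ((j : ℤ) - l) =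
          c j + star a * c (j - n) := by
      intro j
      simp only [coeff_add, coeff_X_pow, coeff_mul_C, star_add, add_mul, Finset.sum_add_distrib]
      rw [Finset.sum_eq_single_of_mem 0 (by simp) (fun b _ hb => by simp [hb]),
        Finset.sum_eq_single_of_mem n (by simp) (fun b _ hb => by simp [hb])]
      simp
    rw [toeplitzForm_add_left, toeplitzForm_mul_C_left, toeplitzForm_X_pow_left c (by omega),
      toeplitzForm_X_pow_left c (by omega), e, e] at h
    simpa using h
  have h1 := key 1
  obtain ⟨i, hr, hI, hJ, hK⟩ : ∃ i : ℍ[ℝ], i.re = 0 ∧ i.imI = 1 ∧ i.imJ = 0 ∧ i.imK = 0 :=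
    ⟨⟨0, 1, 0, 0⟩, rfl, rfl, rfl, rfl⟩
  have h2 := key i
  rw [im_eq_zero_iff] at h0 h1 h2
  simp only [star_one, one_mul, mul_one, add_mul, Quaternion.imI_add, Quaternion.imJ_add,
    Quaternion.imK_add, Quaternion.re_mul, Quaternion.imI_mul, Quaternion.imJ_mul,
    Quaternion.imK_mul, Quaternion.re_star, Quaternion.imI_star, Quaternion.imJ_star,
    Quaternion.imK_star, hr, hI, hJ, hK, h0] at h1 h2
  apply Quaternion.ext <;>
    simp only [Quaternion.re_star, Quaternion.imI_star, Quaternion.imJ_star, Quaternion.imK_star]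
      <;> linarith

theorem star_apply {c : ℤ → ℍ[ℝ]} (hc : IsNontrivialPosDef c) (m : ℤ) :
    star (c m) = c (-m) := by
  obtain ⟨n, rfl | rfl⟩ := m.eq_nat_or_neg
  · exact (neg_natCast_eq_star hc n).symm
  · rw [neg_natCast_eq_star hc, star_star, neg_neg]

theorem star_toeplitzForm {c : ℤ → ℍ[ℝ]} (hc : IsNontrivialPosDef c) (N : ℕ) (φ ψ : ℍ[ℝ][X]) :
    star (toeplitzForm c N φ ψ) = toeplitzForm c N ψ φ := by
  simp only [toeplitzForm, star_sum, star_mul, star_star, star_apply hc, neg_sub, ← mul_assoc]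
  rw [Finset.sum_comm]

/-- Reversing the order of the indices turns the Toeplitz matrix of `c` into that of `star ∘ c`. -/
theorem isNontrivialPosDef_star {c : ℤ → ℍ[ℝ]} (hc : IsNontrivialPosDef c) :
    IsNontrivialPosDef (star ∘ c) := by
  intro n ξ hξ
  have h := hc n (ξ ∘ Fin.rev) (fun h => hξ (funext fun i => by simpa using congrFun h i.rev))
  convert h using 1
  simp only [dotProduct, Matrix.mulVec]
  rw [← Equiv.sum_comp Fin.revPerm]
  refine Finset.sum_congr rfl fun i _ => ?_
  rw [← Equiv.sum_comp Fin.revPerm]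
  simp only [Pi.star_apply, Function.comp, Fin.revPerm_apply]
  refine congrArg _ (Finset.sum_congr rfl fun j _ => congrArg (· * _) ?_)
  simp only [toeplitz, Matrix.of_apply]
  rw [Function.comp_apply, star_apply hc]
  exact congrArg c (by rw [Fin.val_rev, Fin.val_rev]; omega)

/-! ### Gram–Schmidt -/

theorem toeplitzForm_mul_C_right (c : ℤ → ℍ[ℝ]) (N : ℕ) (φ ψ : ℍ[ℝ][X]) (a : ℍ[ℝ]) :
    toeplitzForm c N φ (ψ * C a) = star a * toeplitzForm c N φ ψ := by
  simp [toeplitzForm, Finset.mul_sum, mul_assoc]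

theorem toeplitzForm_add_right (c : ℤ → ℍ[ℝ]) (N : ℕ) (φ ψ ψ' : ℍ[ℝ][X]) :
    toeplitzForm c N φ (ψ + ψ') = toeplitzForm c N φ ψ + toeplitzForm c N φ ψ' := by
  simp [toeplitzForm, add_mul, Finset.sum_add_distrib]

theorem IsPosReal.eq_coe {q : ℍ[ℝ]} (h : IsPosReal q) : q = (q.re : ℍ[ℝ]) := by
  simpa [h.1] using (Quaternion.re_add_im q).symm

/-- The last clause serves to pass from orthogonality against earlier polynomials to orthogonality
against monomials. -/
theorem rightON_spec {c : ℤ → ℍ[ℝ]} (hc : IsNontrivialPosDef c) (n : ℕ) :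
    (rightON c n).natDegree = n ∧ formR c (rightON c n) (rightON c n) = 1 ∧
      (∀ k < n, formR c (rightON c n) (rightON c k) = 0) ∧
      ∃ a : ℕ → ℍ[ℝ], X ^ n = ∑ k ∈ Finset.range (n + 1), rightON c k * C (a k) := by
  induction n using Nat.strong_induction_on with
  | _ n ih =>
    obtain ⟨s, hs⟩ : ∃ s, s = ∑ k : Fin n, rightON c k.1 * C (formR c (X ^ n) (rightON c k.1)) :=
      ⟨_, rfl⟩
    obtain ⟨m, hm⟩ : ∃ m, m = X ^ n - s := ⟨_, rfl⟩
    obtain ⟨r, hr⟩ : ∃ r : ℝ, r = (Real.sqrt (formR c m m).re)⁻¹ := ⟨_, rfl⟩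
    have he : rightON c n = m * C (r : ℍ[ℝ]) := by
      rw [rightON, hr, hm, hs]
    have hdeg : ∀ k < n, (rightON c k).natDegree < n + 1 := fun k hk => by
      rw [(ih k hk).1]; omega
    have hsd : s.natDegree ≤ n := by
      rw [hs]
      refine natDegree_sum_le_of_forall_le _ _ fun k _ => (natDegree_mul_C_le _ _).trans ?_
      rw [(ih k k.2).1]
      exact k.2.le
    have hsn : s.coeff n = 0 := by
      rw [hs, finsetSum_coeff]
      refine Finset.sum_eq_zero fun k _ => ?_
      rw [coeff_mul_C, coeff_eq_zero_of_natDegree_lt, zero_mul]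
      rw [(ih k k.2).1]
      exact k.2
    have hmn : m.coeff n = 1 := by rw [hm, coeff_sub, coeff_X_pow_self, hsn, sub_zero]
    have hm0 : m ≠ 0 := fun h => by simp [h] at hmn
    have hmd : m.natDegree < n + 1 := by
      rw [hm]
      exact Nat.lt_succ_of_le
        ((natDegree_sub_le_of_le (natDegree_X_pow_le n) hsd).trans (max_self n).le)
    have hpos := toeplitzForm_pos hc hmd hm0
    have hr0 : r ≠ 0 := by
      rw [hr, formR_eq c hmd hmd]
      exact inv_ne_zero (Real.sqrt_ne_zero'.2 hpos.2)
    have hrr : r * (toeplitzForm c (n + 1) m m).re * r = 1 := by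
      rw [hr, formR_eq c hmd hmd]
      have h1 := Real.mul_self_sqrt hpos.2.le
      have h2 := Real.sqrt_ne_zero'.2 hpos.2
      field_simp
      rw [sq, h1]
    have hed : (rightON c n).natDegree = n := by
      refine le_antisymm ?_ (le_natDegree_of_ne_zero ?_)
      · rw [he]
        exact (natDegree_mul_C_le _ _).trans (Nat.le_of_lt_succ hmd)
      · rw [he, coeff_mul_C, hmn, one_mul]
        exact fun h => hr0 (Quaternion.coe_injective h)
    have hed' : (rightON c n).natDegree < n + 1 := by omega
    have horth : ∀ i < n, ∀ j < n, toeplitzForm c (n + 1) (rightON c i) (rightON c j) =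
        if i = j then 1 else 0 := by
      intro i hi j hj
      split_ifs with hij
      · subst hij
        rw [← formR_eq c (hdeg i hi) (hdeg i hi), (ih i hi).2.1]
      · rcases lt_or_gt_of_ne hij with h | h
        · rw [← star_toeplitzForm hc, ← formR_eq c (hdeg j hj) (hdeg i hi), (ih j hj).2.2.1 i h,
            star_zero]
        · rw [← formR_eq c (hdeg i hi) (hdeg j hj), (ih i hi).2.2.1 j h]
    refine ⟨hed, ?_, fun j hj => ?_, ?_⟩
    · rw [formR_eq c hed' hed', he, toeplitzForm_mul_C_left, toeplitzForm_mul_C_right, hpos.eq_coe,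
        Quaternion.star_coe, ← Quaternion.coe_mul, ← Quaternion.coe_mul, hrr, Quaternion.coe_one]
    · rw [formR_eq c hed' (hdeg j hj), he, toeplitzForm_mul_C_left, hm, toeplitzForm_sub_left, hs,
        toeplitzForm_sum_left, Finset.sum_eq_single_of_mem ⟨j, hj⟩ (Finset.mem_univ _),
        toeplitzForm_mul_C_left, horth j hj j hj, if_pos rfl, one_mul,
        formR_eq c (by simp) (hdeg j hj), sub_self, zero_mul]
      intro k _ hk
      rw [toeplitzForm_mul_C_left, horth k k.2 j hj, if_neg (fun h => hk (Fin.ext h)), zero_mul]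
    · refine ⟨fun k => if k = n then ((r⁻¹ : ℝ) : ℍ[ℝ]) else formR c (X ^ n) (rightON c k), ?_⟩
      rw [Finset.sum_range_succ]
      simp only [if_true]
      rw [he, mul_assoc, ← C_mul, ← Quaternion.coe_mul,
        mul_inv_cancel₀ hr0, Quaternion.coe_one, C_1, mul_one, Finset.sum_range, hm, hs,
        add_comm, eq_comm]
      convert sub_add_cancel _ _ using 3 with k
      rw [if_neg k.2.ne]

theorem natDegree_rightON {c : ℤ → ℍ[ℝ]} (hc : IsNontrivialPosDef c) (n : ℕ) :
    (rightON c n).natDegree = n := (rightON_spec hc n).1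

theorem rightON_ne_zero {c : ℤ → ℍ[ℝ]} (hc : IsNontrivialPosDef c) (n : ℕ) :
    rightON c n ≠ 0 := fun h => by
  have := (rightON_spec hc n).2.1
  rw [h, formR_eq c (N := 1) (by simp) (by simp)] at this
  simp [toeplitzForm] at this

theorem toeplitzForm_rightON_X_pow {c : ℤ → ℍ[ℝ]} (hc : IsNontrivialPosDef c) {n j : ℕ}
    (hj : j < n) : toeplitzForm c (n + 1) (rightON c n) (X ^ j) = 0 := by
  obtain ⟨a, ha⟩ := (rightON_spec hc j).2.2.2
  have hd : ∀ k ≤ n, (rightON c k).natDegree < n + 1 := fun k hk => by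
    rw [natDegree_rightON hc]; omega
  rw [← star_toeplitzForm hc, ha, toeplitzForm_sum_left, Finset.sum_eq_zero, star_zero]
  intro k hk
  have hk : k < n := by have := Finset.mem_range.1 hk; omega
  rw [toeplitzForm_mul_C_left, ← star_toeplitzForm hc, ← formR_eq c (hd n le_rfl) (hd k hk.le),
    (rightON_spec hc n).2.2.1 k hk, star_zero, zero_mul]

theorem toeplitzForm_eq_zero_of_X_pow {c : ℤ → ℍ[ℝ]} (hc : IsNontrivialPosDef c) {n N : ℕ}
    {φ ψ : ℍ[ℝ][X]} (hφ : ∀ j < n, toeplitzForm c N φ (X ^ j) = 0)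
    (hψ : ∀ k, n ≤ k → ψ.coeff k = 0) : toeplitzForm c N φ ψ = 0 := by
  have e : ψ = ∑ k ∈ Finset.range n, X ^ k * C (ψ.coeff k) := by
    ext1 k
    simp only [finsetSum_coeff, coeff_mul_C, coeff_X_pow, ite_mul, one_mul, zero_mul,
      Finset.sum_ite_eq, Finset.mem_range]
    split_ifs with h
    · rfl
    · exact hψ k (by omega)
  rw [← star_toeplitzForm hc, e, toeplitzForm_sum_left, Finset.sum_eq_zero, star_zero]
  intro k hk
  rw [toeplitzForm_mul_C_left, ← star_toeplitzForm hc, hφ k (Finset.mem_range.1 hk), star_zero,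
    zero_mul]

/-- A polynomial of degree at most `n` that is orthogonal to `1, …, p^(n-1)` is a multiple of the
orthonormal polynomial of degree `n`. -/
theorem eq_rightON_mul_C {c : ℤ → ℍ[ℝ]} (hc : IsNontrivialPosDef c) {n : ℕ} {φ : ℍ[ℝ][X]}
    (hd : φ.natDegree ≤ n) (hφ : ∀ j < n, toeplitzForm c (n + 1) φ (X ^ j) = 0) :
    ∃ b, φ = rightON c n * C b := by
  have hl : (rightON c n).coeff n ≠ 0 := by
    have := leadingCoeff_ne_zero.2 (rightON_ne_zero hc n)
    rwa [leadingCoeff, natDegree_rightON hc] at this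
  refine ⟨((rightON c n).coeff n)⁻¹ * φ.coeff n, sub_eq_zero.1 ?_⟩
  by_contra h0
  set ρ := φ - rightON c n * C (((rightON c n).coeff n)⁻¹ * φ.coeff n) with hρ
  have hρd : ρ.natDegree ≤ n := (natDegree_sub_le_of_le hd
    ((natDegree_mul_C_le _ _).trans (natDegree_rightON hc n).le)).trans (max_self n).le
  have hpos := toeplitzForm_pos hc (Nat.lt_succ_of_le hρd) h0
  rw [toeplitzForm_eq_zero_of_X_pow hc (n := n)] at hpos
  · exact lt_irrefl _ hpos.2
  · intro j hj
    rw [hρ, toeplitzForm_sub_left, toeplitzForm_mul_C_left, hφ j hj,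
      toeplitzForm_rightON_X_pow hc hj, zero_mul, sub_zero]
  · intro k hk
    rcases hk.eq_or_lt with rfl | hk
    · rw [hρ, coeff_sub, coeff_mul_C, mul_inv_cancel_left₀ hl, sub_self]
    · exact coeff_eq_zero_of_natDegree_lt (by omega)

/-! ### Location of the zeros -/

theorem natDegree_mul_X_sub_C' {g : ℍ[ℝ][X]} (hg : g ≠ 0) (q : ℍ[ℝ]) :
    (g * (X - C q)).natDegree = g.natDegree + 1 := by
  rw [natDegree_mul hg (X_sub_C_ne_zero q), natDegree_X_sub_C]

theorem exists_factor_rightON {c : ℤ → ℍ[ℝ]} (hc : IsNontrivialPosDef c) {n : ℕ} {q : ℍ[ℝ]}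
    (h : evalRS q (rightON c n) = 0) :
    ∃ g : ℍ[ℝ][X], g ≠ 0 ∧ g.natDegree < n ∧ X * g = rightON c n + g * C q := by
  obtain ⟨g, hg⟩ := exists_eq_mul_X_sub_C h
  have hg0 : g ≠ 0 := fun h0 => rightON_ne_zero hc n (by rw [hg, h0, zero_mul])
  refine ⟨g, hg0, ?_, ?_⟩
  · have := natDegree_rightON hc n
    rw [hg, natDegree_mul_X_sub_C' hg0] at this
    omega
  · rw [hg, mul_sub, sub_add_cancel, X_mul]

theorem norm_lt_one_of_evalRS_rightON {c : ℤ → ℍ[ℝ]} (hc : IsNontrivialPosDef c) {n : ℕ}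
    {q : ℍ[ℝ]} (h : evalRS q (rightON c n) = 0) : ‖q‖ < 1 := by
  obtain ⟨g, hg0, hgd, hg⟩ := exists_factor_rightON hc h
  have hpos := toeplitzForm_pos hc hgd hg0
  have h1 : toeplitzForm c (n + 1) (rightON c n) (g * C q) = 0 :=
    toeplitzForm_eq_zero_of_X_pow hc
      (fun j hj => toeplitzForm_rightON_X_pow hc hj)
      (fun k hk => by
        rw [coeff_mul_C, coeff_eq_zero_of_natDegree_lt (hgd.trans_le hk), zero_mul])
  have h2 : toeplitzForm c (n + 1) (X * g) (rightON c n) = 1 := by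
    have hd : (rightON c n).natDegree < n + 1 := by rw [natDegree_rightON hc]; omega
    rw [hg, toeplitzForm_add_left, ← star_toeplitzForm hc _ (rightON c n) (g * C q), h1, star_zero,
      add_zero, ← formR_eq c hd hd, (rightON_spec hc n).2.1]
  have h3 : toeplitzForm c (n + 1) (X * g) (g * C q) =
      star q * (toeplitzForm c n g g * q) := by
    rw [hg, toeplitzForm_add_left, h1, zero_add, toeplitzForm_mul_C_left, toeplitzForm_mul_C_right,
      toeplitzForm_eq_of_le c (Nat.le_succ n) hgd hgd, mul_assoc]
  have h4 : toeplitzForm c n g g = 1 + star q * (toeplitzForm c n g g * q) := by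
    rw [← h3, ← h2, ← toeplitzForm_add_right, ← hg, toeplitzForm_X_mul]
  rw [hpos.eq_coe, Quaternion.coe_commutes, ← mul_assoc, Quaternion.star_mul_self,
    ← Quaternion.coe_one, ← Quaternion.coe_mul, ← Quaternion.coe_add, Quaternion.coe_inj,
    Quaternion.normSq_eq_norm_mul_self] at h4
  have := hpos.2
  have := norm_nonneg q
  by_contra! h5
  nlinarith [mul_le_mul h5 h5 zero_le_one (by positivity)]

theorem zerosLS_rightON_subset {c : ℤ → ℍ[ℝ]} (hc : IsNontrivialPosDef c) (n : ℕ) :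
    zerosLS (rightON c n) ⊆ Metric.ball 0 1 := by
  intro q hq
  obtain ⟨q', h, h'⟩ := exists_evalRS_eq_zero hq
  rw [mem_ball_zero_iff, ← h.norm_eq]
  exact norm_lt_one_of_evalRS_rightON hc h'

theorem mem_zerosRS_conjPoly {q : ℍ[ℝ]} {φ : ℍ[ℝ][X]} :
    q ∈ zerosRS (conjPoly φ) ↔ star q ∈ zerosLS φ := by
  simp [zerosRS, zerosLS, evalRS_conjPoly]

theorem zerosRS_leftON_subset {c : ℤ → ℍ[ℝ]} (hc : IsNontrivialPosDef c) (n : ℕ) :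
    zerosRS (leftON c n) ⊆ Metric.ball 0 1 := by
  intro q hq
  rw [leftON_eq, mem_zerosRS_conjPoly] at hq
  simpa using zerosLS_rightON_subset (isNontrivialPosDef_star hc) n hq

theorem coeff_zero_reversePoly (φ : ℍ[ℝ][X]) :
    (reversePoly φ).coeff 0 = star φ.leadingCoeff := by
  rw [reversePoly, finsetSum_coeff, Finset.sum_range_succ, Finset.sum_eq_zero, zero_add,
    Nat.sub_self, coeff_monomial_same, leadingCoeff]
  intro k hk
  have := Finset.mem_range.1 hk
  exact coeff_monomial_of_ne _ (by omega)

theorem evalRS_zero (φ : ℍ[ℝ][X]) : evalRS 0 φ = φ.coeff 0 := by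
  rw [evalRS_eq_eval, coeff_zero_eq_eval_zero]

theorem evalLS_zero (φ : ℍ[ℝ][X]) : evalLS 0 φ = φ.coeff 0 := by
  have h := evalRS_conjPoly 0 φ
  rw [evalRS_zero, coeff_conjPoly, star_zero] at h
  exact (star_injective h).symm

theorem one_lt_norm_of_star_inv {p : ℍ[ℝ]} (hp : p ≠ 0)
    (h : (star p)⁻¹ ∈ Metric.ball (0 : ℍ[ℝ]) 1) : p ∈ (Metric.closedBall (0 : ℍ[ℝ]) 1)ᶜ := by
  rw [mem_ball_zero_iff, norm_inv, norm_star, inv_lt_one₀ (norm_pos_iff.2 hp)] at h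
  simpa using h

theorem zerosRS_reversePoly_subset {φ : ℍ[ℝ][X]} (h0 : φ ≠ 0)
    (h : zerosLS φ ⊆ Metric.ball 0 1) : zerosRS (reversePoly φ) ⊆ (Metric.closedBall 0 1)ᶜ := by
  intro p hp
  rw [zerosRS, Set.mem_ofPred_eq] at hp
  by_cases hp0 : p = 0
  · rw [hp0, evalRS_zero, coeff_zero_reversePoly, star_eq_zero, leadingCoeff_eq_zero] at hp
    exact absurd hp h0
  · rw [evalRS_reversePoly _ _ hp0] at hp
    exact one_lt_norm_of_star_inv hp0
      (h (star_eq_zero.1 ((mul_eq_zero.1 hp).resolve_right (pow_ne_zero _ hp0))))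

theorem zerosLS_reversePoly_subset {φ : ℍ[ℝ][X]} (h0 : φ ≠ 0)
    (h : zerosRS φ ⊆ Metric.ball 0 1) : zerosLS (reversePoly φ) ⊆ (Metric.closedBall 0 1)ᶜ := by
  intro p hp
  rw [zerosLS, Set.mem_ofPred_eq] at hp
  by_cases hp0 : p = 0
  · rw [hp0, evalLS_zero, coeff_zero_reversePoly, star_eq_zero, leadingCoeff_eq_zero] at hp
    exact absurd hp h0
  · rw [evalLS_reversePoly _ _ hp0] at hp
    exact one_lt_norm_of_star_inv hp0
      (h (star_eq_zero.1 ((mul_eq_zero.1 hp).resolve_left (pow_ne_zero _ hp0))))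

/-! ### Right and left eigenvalues of quaternionic matrices -/

section Matrix

open Matrix

theorem exists_mul_eq_one_of_vecMul {m : ℕ} (A : Matrix (Fin m) (Fin m) ℍ[ℝ])
    (h : ∀ v : Fin m → ℍ[ℝ], v ᵥ* A = 0 → v = 0) : ∃ B, B * A = 1 := by
  have hinj : Function.Injective A.vecMulLinear :=
    (injective_iff_map_eq_zero A.vecMulLinear).2 fun v hv => h v hv
  have hsurj := LinearMap.injective_iff_surjective.1 hinj
  choose v hv using fun i : Fin m => hsurj (Pi.single i 1)
  refine ⟨Matrix.of v, Matrix.ext fun i j => ?_⟩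
  have := congrFun (hv i) j
  rw [Matrix.vecMulLinear_apply] at this
  rw [Matrix.one_apply, Matrix.mul_apply_eq_vecMul]
  refine this.trans ?_
  rw [Pi.single_apply]
  simp only [eq_comm]

/-- A right eigenvalue of a quaternionic matrix is similar to a left one, for row vectors. -/
theorem exists_vecMul_eq_smul {m : ℕ} {A : Matrix (Fin m) (Fin m) ℍ[ℝ]} {g : Fin m → ℍ[ℝ]}
    (hg : g ≠ 0) {q : ℍ[ℝ]} (h : A *ᵥ g = MulOpposite.op q • g) :
    ∃ r, SameClass r q ∧ ∃ w : Fin m → ℍ[ℝ], w ≠ 0 ∧ w ᵥ* A = r • w := by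
  obtain ⟨t, ht⟩ : ∃ t : ℝ, t = 2 * q.re := ⟨_, rfl⟩
  obtain ⟨s, hs⟩ : ∃ s : ℝ, s = Quaternion.normSq q := ⟨_, rfl⟩
  have hqq : q * q = (t : ℍ[ℝ]) * q - s := by rw [mul_self_eq, ht, hs]
  -- The quadratic of q has real coefficients, so evaluated at A it kills g; being singular, it also
  -- has a row null vector.
  obtain ⟨v, hvP, hv⟩ : ∃ v : Fin m → ℍ[ℝ], v ᵥ* (A * A - t • A + s • 1) = 0 ∧ v ≠ 0 := by
    by_contra! H
    obtain ⟨B, hB⟩ := exists_mul_eq_one_of_vecMul _ H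
    refine hg ?_
    have hP : (A * A - t • A + s • 1) *ᵥ g = 0 := by
      rw [add_mulVec, sub_mulVec, ← mulVec_mulVec, h, mulVec_smul, h, smul_mulVec, smul_mulVec, h,
        one_mulVec]
      ext1 i
      simp only [Pi.add_apply, Pi.sub_apply, Pi.smul_apply, MulOpposite.smul_eq_mul_unop,
        MulOpposite.unop_op, Pi.zero_apply, mul_assoc, hqq, mul_sub]
      rw [← Quaternion.coe_mul_eq_smul, ← Quaternion.coe_mul_eq_smul, Quaternion.coe_commutes s,
        ← mul_assoc (g i), ← mul_assoc (t : ℍ[ℝ]), Quaternion.coe_commutes t]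
      abel
    rw [← one_mulVec g, ← hB, ← mulVec_mulVec, hP, mulVec_zero]
  -- On rows the quadratic factors as (A - q)(A - conj q), so either v is an eigenvector for `star
  -- q`, or the second factor sends v to an eigenvector for q.
  by_cases h0 : v ᵥ* A = star q • v
  · exact ⟨star q, sameClass_star q, v, hv, h0⟩
  · refine ⟨q, .refl q, v ᵥ* A - star q • v, sub_ne_zero.2 h0, ?_⟩
    rw [vecMul_add, vecMul_sub, ← vecMul_vecMul, vecMul_smul, vecMul_smul, vecMul_one] at hvP
    have e : (v ᵥ* A) ᵥ* A = t • (v ᵥ* A) - s • v := by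
      rw [eq_sub_iff_add_eq, ← sub_eq_zero, ← hvP]
      abel
    rw [sub_vecMul, smul_vecMul, e]
    ext1 i
    have e1 : star q = (t : ℍ[ℝ]) - q := by
      rw [ht]
      exact eq_sub_of_add_eq' (Quaternion.self_add_star' q)
    have e2 : q * star q = (s : ℍ[ℝ]) := by rw [hs, Quaternion.self_mul_star]
    simp only [Pi.sub_apply, Pi.smul_apply, smul_eq_mul, mul_sub, ← mul_assoc, e2]
    rw [← Quaternion.coe_mul_eq_smul, ← Quaternion.coe_mul_eq_smul, e1]
    noncomm_ring

end Matrix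

/-! ### Comparison of the zeros of the left and right polynomials -/

theorem evalRS_mul_C (q b : ℍ[ℝ]) (hb : b ≠ 0) (φ : ℍ[ℝ][X]) :
    evalRS q (φ * C b) = evalRS (b * q * b⁻¹) φ * b := by
  simp only [evalRS_eq_eval]
  induction φ using Polynomial.induction_on' with
  | add f g hf hg => rw [add_mul, eval_add, eval_add, hf, hg, add_mul]
  | monomial k a =>
    rw [monomial_mul_C, eval_monomial, eval_monomial, mul_assoc, mul_assoc]
    congr 1
    induction k with
    | zero => simp
    | succ k ih => rw [pow_succ, ← mul_assoc, ih, pow_succ, mul_assoc, mul_assoc _ _ b,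
        inv_mul_cancel_right₀ hb, mul_assoc]

theorem exists_coeff_eq {m : ℕ} (v : Fin (m + 1) → ℍ[ℝ]) :
    ∃ f : ℍ[ℝ][X], f.natDegree ≤ m ∧ ∀ k : Fin (m + 1), f.coeff k = v k := by
  refine ⟨∑ i : Fin (m + 1), monomial (i : ℕ) (v i), ?_, fun k => ?_⟩
  · exact natDegree_sum_le_of_forall_le _ _ fun i _ =>
      (natDegree_monomial_le _).trans (Nat.le_of_lt_succ i.2)
  · simp [finsetSum_coeff, coeff_monomial, Fin.val_inj]

theorem toeplitzForm_X_mul_sub (c : ℤ → ℍ[ℝ]) {n j : ℕ} (hj : j < n) {f : ℍ[ℝ][X]}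
    (hf : f.natDegree < n) (r : ℍ[ℝ]) :
    toeplitzForm c (n + 1) (X * f - f * C r) (X ^ j) =
      (∑ k : Fin n, c ((k : ℤ) + 1 - j) * f.coeff k) -
        (∑ k : Fin n, c ((k : ℤ) - j) * f.coeff k) * r := by
  rw [toeplitzForm_sub_left, toeplitzForm_mul_C_left,
    toeplitzForm_eq_of_le c (Nat.le_succ n) hf (by simpa using hj),
    toeplitzForm_X_pow_right c hj, toeplitzForm_X_pow_right c (by omega), Finset.sum_range_succ',
    coeff_X_mul_zero, mul_zero, add_zero, Finset.sum_range, Finset.sum_range]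
  simp only [coeff_X_mul, Nat.cast_add, Nat.cast_one]

theorem exists_evalRS_rightON_star {c : ℤ → ℍ[ℝ]} (hc : IsNontrivialPosDef c) {n : ℕ} {q : ℍ[ℝ]}
    (h : evalRS q (rightON c n) = 0) :
    ∃ q', SameClass q' q ∧ evalRS q' (rightON (star ∘ c) n) = 0 := by
  obtain ⟨g, hg0, hgd, hg⟩ := exists_factor_rightON hc h
  obtain ⟨m, rfl⟩ : ∃ m, n = m + 1 := ⟨n - 1, by omega⟩
  let T : Matrix (Fin (m + 1)) (Fin (m + 1)) ℍ[ℝ] := Matrix.of fun k j => c ((j : ℤ) + 1 - k)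
  -- A row null vector v would make the positive form vanish at `star v`.
  obtain ⟨B, hB⟩ : ∃ B, B * toeplitz c m = 1 := by
    refine exists_mul_eq_one_of_vecMul _ fun v hv => ?_
    by_contra hv0
    have hp := hc m (star v) (star_ne_zero.2 hv0)
    rw [Matrix.dotProduct_mulVec, star_star, hv, zero_dotProduct] at hp
    exact lt_irrefl _ hp.2
  have hB' : toeplitz c m * B = 1 := mul_eq_one_comm.1 hB
  let G : Fin (m + 1) → ℍ[ℝ] := fun k => g.coeff k
  have hG0 : G ≠ 0 := fun hG => hg0 <| Polynomial.ext fun k => by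
    by_cases hk : k < m + 1
    · exact congrFun hG ⟨k, hk⟩
    · exact coeff_eq_zero_of_natDegree_lt (by omega)
  have hTG : Matrix.mulVec T G = MulOpposite.op q • Matrix.mulVec (toeplitz c m) G := by
    ext1 j
    have h1 := toeplitzForm_rightON_X_pow hc j.2
    rw [eq_sub_of_add_eq hg.symm, toeplitzForm_X_mul_sub c j.2 hgd] at h1
    exact sub_eq_zero.1 h1
  obtain ⟨r, hr, w, hw0, hw⟩ := exists_vecMul_eq_smul (A := B * T) hG0 (q := q) (by
    rw [← Matrix.mulVec_mulVec, hTG, Matrix.mulVec_smul, Matrix.mulVec_mulVec, hB,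
      Matrix.one_mulVec])
  obtain ⟨u, hu⟩ : ∃ u, u = Matrix.vecMul w B := ⟨_, rfl⟩
  have huw : Matrix.vecMul u (toeplitz c m) = w := by
    rw [hu, Matrix.vecMul_vecMul, hB, Matrix.vecMul_one]
  have huT : Matrix.vecMul u T = r • Matrix.vecMul u (toeplitz c m) := by
    rw [huw, hu, Matrix.vecMul_vecMul, hw]
  -- Conjugation turns the row relation into a column relation for `star ∘ c`; reversing the indices
  -- restores the Toeplitz order of the entries.
  obtain ⟨f, hfd, hf⟩ := exists_coeff_eq fun k => star (u k.rev)
  have hf0 : f ≠ 0 := by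
    rintro rfl
    refine hw0 (huw ▸ ?_)
    rw [show u = 0 from funext fun k => by simpa using (hf k.rev).symm, Matrix.zero_vecMul]
  have hfX : f * (X - C (star r)) = X * f - f * C (star r) := by rw [mul_sub, X_mul]
  obtain ⟨b, hb⟩ := eq_rightON_mul_C (isNontrivialPosDef_star hc) (n := m + 1)
    (φ := f * (X - C (star r))) (by rw [natDegree_mul_X_sub_C' hf0]; omega) (by
      intro j hj
      rw [hfX, toeplitzForm_X_mul_sub _ hj (by omega), ← star_eq_zero, ← sub_eq_zero.2
        (congrFun huT (Fin.rev ⟨j, hj⟩))]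
      rw [star_sub, star_mul, star_star, star_sum, star_sum, Pi.smul_apply, smul_eq_mul]
      refine congrArg₂ (· - r * ·) ?_ ?_ <;>
      · rw [Matrix.vecMul, dotProduct, ← Equiv.sum_comp Fin.revPerm]
        refine Finset.sum_congr rfl fun k _ => ?_
        rw [star_mul, hf, star_star, Function.comp_apply, star_star, Fin.revPerm_apply,
          Fin.rev_rev]
        refine congrArg (u k * c ·) ?_
        rw [Fin.val_rev, Fin.val_rev]
        dsimp only
        omega)
  have hb0 : b ≠ 0 := by
    rintro rfl
    rw [C_0, mul_zero] at hb
    exact mul_ne_zero hf0 (X_sub_C_ne_zero _) hb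
  refine ⟨b * star r * b⁻¹, (sameClass_conj _ hb0).trans ((sameClass_star r).trans hr), ?_⟩
  have h2 : evalRS (star r) (f * (X - C (star r))) = 0 := by
    rw [evalRS_eq_eval, eval_mul_X_sub_C]
  rw [hb, evalRS_mul_C _ _ hb0] at h2
  exact (mul_eq_zero.1 h2).resolve_right hb0

theorem star_comp_star_comp (c : ℤ → ℍ[ℝ]) : star ∘ star ∘ c = c :=
  funext fun _ => star_star _

theorem simClosure_zerosRS_rightON_star {c : ℤ → ℍ[ℝ]} (hc : IsNontrivialPosDef c) (n : ℕ) :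
    simClosure (zerosRS (rightON (star ∘ c) n)) = simClosure (zerosRS (rightON c n)) := by
  ext q
  simp only [mem_simClosure]
  constructor
  · rintro ⟨z, hz, h⟩
    obtain ⟨z', h', hz'⟩ := exists_evalRS_rightON_star (isNontrivialPosDef_star hc) hz
    rw [star_comp_star_comp] at hz'
    exact ⟨z', hz', h'.trans h⟩
  · rintro ⟨z, hz, h⟩
    obtain ⟨z', h', hz'⟩ := exists_evalRS_rightON_star hc hz
    exact ⟨z', hz', h'.trans h⟩

theorem simClosure_zerosRS_conjPoly (φ : ℍ[ℝ][X]) :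
    simClosure (zerosRS (conjPoly φ)) = simClosure (zerosLS φ) := by
  ext q
  simp only [mem_simClosure, mem_zerosRS_conjPoly]
  constructor
  · rintro ⟨z, hz, h⟩
    exact ⟨_, hz, (sameClass_star z).trans h⟩
  · rintro ⟨z, hz, h⟩
    exact ⟨star z, by rwa [star_star], (sameClass_star z).trans h⟩

end QuatOPUC

theorem mainTheorem7 (c : ℤ → ℍ[ℝ]) (hc : QuatOPUC.IsNontrivialPosDef c) (n : ℕ) :
    QuatOPUC.zerosRS (QuatOPUC.leftON c n) ⊆ Metric.ball 0 1 ∧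
    QuatOPUC.zerosLS (QuatOPUC.rightON c n) ⊆ Metric.ball 0 1 ∧
    QuatOPUC.zerosLS (QuatOPUC.reversePoly (QuatOPUC.leftON c n)) ⊆ (Metric.closedBall 0 1)ᶜ ∧
    QuatOPUC.zerosRS (QuatOPUC.reversePoly (QuatOPUC.rightON c n)) ⊆ (Metric.closedBall 0 1)ᶜ ∧
    QuatOPUC.simClosure (QuatOPUC.zerosRS (QuatOPUC.leftON c n)) =
      QuatOPUC.simClosure (QuatOPUC.zerosLS (QuatOPUC.rightON c n)) := by
  have hL := QuatOPUC.zerosRS_leftON_subset hc n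
  have hR := QuatOPUC.zerosLS_rightON_subset hc n
  have hL0 : QuatOPUC.leftON c n ≠ 0 := fun h =>
    QuatOPUC.rightON_ne_zero (QuatOPUC.isNontrivialPosDef_star hc) n <| by
      rw [← QuatOPUC.conjPoly_conjPoly (QuatOPUC.rightON _ _), ← QuatOPUC.leftON_eq, h]
      simp [QuatOPUC.conjPoly]
  refine ⟨hL, hR, QuatOPUC.zerosLS_reversePoly_subset hL0 hL,
    QuatOPUC.zerosRS_reversePoly_subset (QuatOPUC.rightON_ne_zero hc n) hR, ?_⟩
  rw [QuatOPUC.leftON_eq, QuatOPUC.simClosure_zerosRS_conjPoly, QuatOPUC.simClosure_zerosLS,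
    QuatOPUC.simClosure_zerosLS, QuatOPUC.simClosure_zerosRS_rightON_star hc]
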